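/- Let $\beta>1$ and $I=[0,1)$, and let $T_\beta\colon I\to I$, $T_\beta x=\beta x-\lfloor\beta x\rfloor$, be the $\beta$-transformation. For $x\in I$ and $n\ge1$ let $\varepsilon_n(x,\beta)=\lfloor\beta T_\beta^{n-1}x\rfloor$ be the $n$-th digit of the $\beta$-expansion of $x$, and for $y\in I$ let $$I_n(y)=\{x\in I\colon \varepsilon_i(x,\beta)=\varepsilon_i(y,\beta),\ 1\le i\le n\}.$$ For $x,y\in I$ define the waiting time $$W_n^\beta(x,y)=\inf\{k\ge1\colon T_\beta^kx\in I_n(y)\}\in\{1,2,\ldots\}\cup\{\infty\},\qquad \inf\emptyset=\infty,$$ and, with $\log\infty=\infty$, the lower and upper quantitative waiting time indicators $$\underline R^\beta(x,y)=\liminf_{n\to\infty}\frac{\log W_n^\beta(x,y)}{n},\qquad \overline R^\beta(x,y)=\limsup_{n\to\infty}\frac{\log W_n^\beta(x,y)}{n}.$$ If they coincide, their common value in $[0,\infty]$ is denoted by $R^\beta(x,y)$. Then for every $\beta>1$ and every $0\le a\le\infty$, the level set $$E_\beta(a)=\{(x,y)\in I^2\colon R^\beta(x,y)\text{ exists and equals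 }a\}\subset\mathbb R^2$$ has Hausdorff dimension $2$. -/

import Mathlib

open Set Filter
open scoped ENNReal

namespace BetaWaiting

noncomputable section

/-- The `β`-transformation `T_β x = βx - [βx]`. -/
def T (β : ℝ) (x : ℝ) : ℝ := β * x - ⌊β * x⌋

/-- The `n`-th digit `[β T_β^{n-1} x]` of the `β`-expansion of `x`, for `n ≥ 1`. -/
def digit (β : ℝ) (n : ℕ) (x : ℝ) : ℤ := ⌊β * (T β)^[n - 1] x⌋

/-- The basic interval `I_n(y)` of order `n` containing `y`: the points of `[0,1)` whose first `n`
digits are those of `y`. -/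
def basicInterval (β : ℝ) (n : ℕ) (y : ℝ) : Set ℝ :=
  {x | x ∈ Ico (0 : ℝ) 1 ∧ ∀ i ∈ Finset.Icc 1 n, digit β i x = digit β i y}

/-- The waiting time `W_n(x,y) = inf {k ≥ 1 : T_β^k x ∈ I_n(y)}`, with `inf ∅ = ∞`. -/
def waitingTime (β : ℝ) (n : ℕ) (x y : ℝ) : ℕ∞ :=
  sInf ((fun k : ℕ => (k : ℕ∞)) '' {k : ℕ | 1 ≤ k ∧ (T β)^[k] x ∈ basicInterval β n y})

/-- `log W_n(x,y) / n` as an extended real number, where `log ∞ = ∞`. -/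
def waitingRate (β : ℝ) (x y : ℝ) (n : ℕ) : EReal :=
  ENNReal.log (waitingTime β n x y : ℝ≥0∞) / (n : EReal)

/-- The lower quantitative waiting time indicator of `y` by `x`. -/
def lowerIndicator (β : ℝ) (x y : ℝ) : EReal := liminf (waitingRate β x y) atTop

/-- The upper quantitative waiting time indicator of `y` by `x`. -/
def upperIndicator (β : ℝ) (x y : ℝ) : EReal := limsup (waitingRate β x y) atTop

/-- The waiting time indicator of `y` by `x` exists and equals `a`. -/
def IndicatorEq (β : ℝ) (x y : ℝ) (a : EReal) : Prop :=
  lowerIndicator β x y = a ∧ upperIndicator β x y = a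

/-- The level set of the waiting time indicator in the unit square `[0,1)²`, as a subset of the
Euclidean plane. -/
def levelSet (β : ℝ) (a : ℝ≥0∞) : Set (EuclideanSpace ℝ (Fin 2)) :=
  {p | p 0 ∈ Ico (0 : ℝ) 1 ∧ p 1 ∈ Ico (0 : ℝ) 1 ∧ IndicatorEq β (p 0) (p 1) (a : EReal)}

end

end BetaWaiting

namespace BetaWaiting

noncomputable section

/-! The upper bound is the dimension of the plane. For the lower bound, a large set of pairs is
coded into the level set, and the coding is inverted by an almost Lipschitz map.

Full words can be concatenated freely, and there are at least `β ^ n / (n + 1)` of length `n`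
(`exists_finset_full`). So for each `r < 1` there is a `BlockCode`: a zero block and `N ≥ β ^ (len *
r)` nonzero blocks of one length `len`. The target `y` is two zero blocks followed by arbitrary
nonzero blocks `v`. The source `x` carries arbitrary nonzero blocks `u`, interrupted at place `p k`
by a copy of the first `k + 3` blocks of `y` and a closing zero block. A pair of adjacent zero
blocks occurs in `x` only where a copy starts, so the first `k + 3` blocks of `y` are first met at
time exactly `len * p k` (`waitingTime_eq`). With `p k` equal to `exp (a * len * k)` up to a
polynomial factor, or at least `exp (k ^ 2)` if `a = ∞`, the rate is `a`.

The copies can be made so sparse that a proportion `r` of the blocks of `x` stays free. Then `(x,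
y)` determines `(u, v)`, read as a pair of base `N` expansions, with Hölder exponent `r * r`. These
pairs fill the open unit square, so the level set has dimension at least `2 * r * r`; let `r → 1`.
-/

/-! ### Inverse branches and full words -/

/-- The inverse branch of `T β ^[n]` with digit word `w 0, …, w (n - 1)`. -/
def branch (β : ℝ) (n : ℕ) (w : ℕ → ℤ) (t : ℝ) : ℝ :=
  ∑ i ∈ Finset.range n, (w i : ℝ) * β⁻¹ ^ (i + 1) + t * β⁻¹ ^ n

/-- A word is full if its cylinder is mapped onto `[0,1)` by `T β ^[n]`. -/
def IsFull (β : ℝ) (n : ℕ) (w : ℕ → ℤ) : Prop :=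
  ∀ t ∈ Ico (0 : ℝ) 1, branch β n w t ∈ Ico (0 : ℝ) 1 ∧
    ∀ i < n, digit β (i + 1) (branch β n w t) = w i

theorem T_mem (β x : ℝ) : T β x ∈ Ico (0 : ℝ) 1 :=
  ⟨Int.fract_nonneg _, Int.fract_lt_one _⟩

theorem T_iterate_mem (β : ℝ) {x : ℝ} (hx : x ∈ Ico (0 : ℝ) 1) (n : ℕ) :
    (T β)^[n] x ∈ Ico (0 : ℝ) 1 := by
  cases n with
  | zero => exact hx
  | succ n => rw [Function.iterate_succ_apply']; exact T_mem _ _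

theorem digit_succ (β x : ℝ) (n : ℕ) : digit β (n + 1) x = ⌊β * (T β)^[n] x⌋ := rfl

theorem digit_iterate (β x : ℝ) (s i : ℕ) :
    digit β (i + 1) ((T β)^[s] x) = digit β (s + i + 1) x := by
  rw [digit_succ, digit_succ, add_comm s i, Function.iterate_add_apply]

theorem iterate_succ_eq (β x : ℝ) (n : ℕ) :
    (T β)^[n + 1] x = β * (T β)^[n] x - digit β (n + 1) x := by
  rw [Function.iterate_succ_apply']; rfl

@[simp] theorem branch_zero (β : ℝ) (w : ℕ → ℤ) (t : ℝ) : branch β 0 w t = t := by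
  simp [branch]

theorem branch_congr {β : ℝ} {n : ℕ} {w w' : ℕ → ℤ} (h : ∀ i < n, w i = w' i) (t : ℝ) :
    branch β n w t = branch β n w' t := by
  unfold branch
  rw [Finset.sum_congr rfl fun i hi => by rw [h i (Finset.mem_range.1 hi)]]

theorem branch_sub (β : ℝ) (n : ℕ) (w : ℕ → ℤ) (s t : ℝ) :
    branch β n w s - branch β n w t = (s - t) * β⁻¹ ^ n := by
  unfold branch; ring

theorem branch_append (β : ℝ) (m n : ℕ) (w : ℕ → ℤ) (t : ℝ) :
    branch β (m + n) w t = branch β m w (branch β n (fun i => w (m + i)) t) := by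
  unfold branch
  rw [Finset.sum_range_add, add_mul, Finset.sum_mul, add_assoc]
  congr 1
  rw [pow_add]
  congr 1
  · exact Finset.sum_congr rfl fun i _ => by ring
  · ring

theorem branch_succ {β : ℝ} (hβ : 0 < β) (n : ℕ) (w : ℕ → ℤ) (t : ℝ) :
    branch β (n + 1) w t = branch β n w ((w n + t) / β) := by
  rw [branch_append]
  congr 1
  simp [branch]
  field_simp

/-- Solving `iterate_succ_eq` for the earlier iterate absorbs one digit at a time. No fullness is
needed: every point lies on the branch of its own digits. -/
theorem branch_digit {β : ℝ} (hβ : 0 < β) (x : ℝ) (n : ℕ) :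
    branch β n (fun i => digit β (i + 1) x) ((T β)^[n] x) = x := by
  induction n with
  | zero => simp
  | succ n ih =>
    rw [branch_succ hβ, iterate_succ_eq]
    convert ih using 2
    field_simp
    ring

theorem IsFull.iterate_branch {β : ℝ} (hβ : 0 < β) {n : ℕ} {w : ℕ → ℤ} (h : IsFull β n w) {t : ℝ}
    (ht : t ∈ Ico (0 : ℝ) 1) : (T β)^[n] (branch β n w t) = t := by
  have h1 := branch_digit hβ (branch β n w t) n
  rw [branch_congr (h t ht).2] at h1
  have h2 := branch_sub β n w ((T β)^[n] (branch β n w t)) t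
  rw [h1, sub_self] at h2
  have : (0 : ℝ) < β⁻¹ ^ n := by positivity
  nlinarith [mul_eq_zero.1 h2.symm |>.resolve_right this.ne']

theorem IsFull.congr {β : ℝ} {n : ℕ} {w w' : ℕ → ℤ} (h : IsFull β n w)
    (hw : ∀ i < n, w i = w' i) : IsFull β n w' := by
  intro t ht
  rw [← branch_congr hw]
  exact ⟨(h t ht).1, fun i hi => by rw [(h t ht).2 i hi, hw i hi]⟩

/-- The inner branch lands in `[0,1)`, which is all that the outer full word requires of its
argument. -/
theorem IsFull.append {β : ℝ} (hβ : 0 < β) {m n : ℕ} {w : ℕ → ℤ} (h : IsFull β m w)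
    (h' : IsFull β n (fun i => w (m + i))) : IsFull β (m + n) w := by
  intro t ht
  rw [branch_append]
  obtain ⟨h1, h2⟩ := h' t ht
  refine ⟨(h _ h1).1, fun i hi => ?_⟩
  rcases lt_or_ge i m with him | him
  · exact (h _ h1).2 i him
  · obtain ⟨r, rfl⟩ := Nat.exists_eq_add_of_le him
    rw [← digit_iterate, h.iterate_branch hβ h1]
    exact h2 r (by omega)

theorem isFull_zero_length (β : ℝ) (w : ℕ → ℤ) : IsFull β 0 w := by
  intro t ht
  simpa using ht

theorem isFull_zero {β : ℝ} (hβ : 1 < β) (n : ℕ) : IsFull β n (fun _ => 0) := by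
  have hβ0 : 0 < β := by linarith
  induction n with
  | zero => exact isFull_zero_length _ _
  | succ n ih =>
    refine ih.append hβ0 ?_
    intro t ht
    have h1 : branch β 1 (fun _ => 0) t = t / β := by simp [branch, div_eq_mul_inv]
    rw [h1]
    refine ⟨⟨div_nonneg ht.1 hβ0.le, ?_⟩, ?_⟩
    · rw [div_lt_one hβ0]; linarith [ht.2]
    · intro i hi
      obtain rfl : i = 0 := by omega
      rw [digit_succ]
      simp only [Function.iterate_zero, id]
      rw [mul_div_cancel₀ _ hβ0.ne', Int.floor_eq_zero_iff]
      exact ht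

theorem branch_zero_word (β : ℝ) (n : ℕ) (t : ℝ) : branch β n (fun _ => 0) t = t * β⁻¹ ^ n := by
  simp [branch]

/-- The word `1 0 … 0` of length `j + 1` is full as soon as `1 + β⁻ʲ ≤ β`. -/
theorem isFull_one_zeros {β : ℝ} (hβ : 1 < β) {j : ℕ} (hj : 1 + β⁻¹ ^ j ≤ β) :
    IsFull β (j + 1) (fun i => if i = 0 then 1 else 0) := by
  have hβ0 : 0 < β := by linarith
  intro t ht
  rw [add_comm j 1, branch_append]
  have e : (fun i => if 1 + i = 0 then (1 : ℤ) else 0) = fun _ => 0 := by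
    funext i; simp
  rw [e]
  obtain ⟨h1, h2⟩ := isFull_zero hβ j t ht
  set s := branch β j (fun _ => 0) t with hs
  have hsj : s < β⁻¹ ^ j := by
    rw [hs, branch_zero_word]
    have : (0 : ℝ) < β⁻¹ ^ j := by positivity
    nlinarith [ht.2]
  have h3 : branch β 1 (fun i => if i = 0 then (1 : ℤ) else 0) s = (1 + s) / β := by
    rw [branch_succ hβ0]; simp
  rw [h3]
  have hfl : ⌊β * ((1 + s) / β)⌋ = 1 := by
    rw [mul_div_cancel₀ _ hβ0.ne', Int.floor_eq_iff]
    push_cast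
    constructor <;> linarith [h1.1, h1.2]
  refine ⟨⟨div_nonneg (by linarith [h1.1]) hβ0.le, ?_⟩, ?_⟩
  · rw [div_lt_one hβ0]; linarith
  · intro i hi
    rcases i with _ | i
    · rw [digit_succ]
      simpa using hfl
    · have hT : (T β)^[1] ((1 + s) / β) = s := by
        rw [iterate_succ_eq, digit_succ]
        simp only [Function.iterate_zero, id]
        rw [hfl, mul_div_cancel₀ _ hβ0.ne']
        simp
      rw [add_comm i 1, ← digit_iterate, hT, h2 i (by omega)]
      simp

/-! ### Counting full words -/

/-- The cylinder of order `n` around `x` has the same right end as a full cylinder of some order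
`k ≤ n` around `x`. -/
theorem exists_full_cylinder {β : ℝ} (hβ : 1 < β) {x : ℝ} (hx : x ∈ Ico (0 : ℝ) 1) (n : ℕ) :
    ∃ s ≤ (1 : ℝ), (T β)^[n] x < s ∧
      (∀ u ∈ Ico (0 : ℝ) s, branch β n (fun i => digit β (i + 1) x) u ∈ Ico (0 : ℝ) 1 ∧
        ∀ i < n, digit β (i + 1) (branch β n (fun i => digit β (i + 1) x) u) =
          digit β (i + 1) x) ∧
      ∃ k ≤ n, IsFull β k (fun i => digit β (i + 1) x) ∧
        s - (T β)^[n] x = β ^ (n - k) * (1 - (T β)^[k] x) := by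
  have hβ0 : 0 < β := by linarith
  induction n with
  | zero =>
    exact ⟨1, le_rfl, hx.2, isFull_zero_length _ _, 0, le_rfl, isFull_zero_length _ _, by simp⟩
  | succ n ih =>
    obtain ⟨s, hs1, hxs, hcyl, k, hk, hfull, hsk⟩ := ih
    set w : ℕ → ℤ := fun i => digit β (i + 1) x with hw
    set y := (T β)^[n] x with hy
    have hy0 := T_iterate_mem β hx n
    have hTy : (T β)^[n + 1] x = β * y - w n := iterate_succ_eq β x n
    have hd0 : (0 : ℝ) ≤ w n := by
      have : (0 : ℤ) ≤ w n := Int.floor_nonneg.2 (mul_nonneg hβ0.le hy0.1)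
      exact_mod_cast this
    have hTmem := T_iterate_mem β hx (n + 1)
    rw [hTy] at hTmem
    have key : ∀ s' ≤ (1 : ℝ), (w n + s') ≤ β * s → ∀ u ∈ Ico (0 : ℝ) s',
        branch β (n + 1) w u ∈ Ico (0 : ℝ) 1 ∧
        ∀ i < n + 1, digit β (i + 1) (branch β (n + 1) w u) = w i := by
      intro s' hs' hle u hu
      rw [branch_succ hβ0]
      have hv : (w n + u) / β ∈ Ico (0 : ℝ) s :=
        ⟨div_nonneg (by linarith [hu.1]) hβ0.le, by rw [div_lt_iff₀ hβ0]; linarith [hu.2]⟩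
      obtain ⟨h1, h2⟩ := hcyl _ hv
      refine ⟨h1, fun i hi => ?_⟩
      rcases Nat.lt_succ_iff_lt_or_eq.1 hi with hi | rfl
      · exact h2 i hi
      · have h3 := branch_digit hβ0 (branch β i w ((w i + u) / β)) i
        rw [branch_congr h2] at h3
        have h4 := branch_sub β i w ((T β)^[i] (branch β i w ((w i + u) / β))) ((w i + u) / β)
        rw [h3, sub_self] at h4
        have h5 : (0 : ℝ) < β⁻¹ ^ i := by positivity
        have h6 := (mul_eq_zero.1 h4.symm).resolve_right h5.ne'
        rw [digit_succ, sub_eq_zero.1 h6, mul_div_cancel₀ _ hβ0.ne', Int.floor_eq_iff]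
        constructor <;> linarith [hu.1, hu.2]
    -- Either the new cylinder is not cut off, so the extended word is itself full and `k` restarts
    -- at `n + 1`, or it is the last piece of its parent and inherits the right end and `k`.
    by_cases hcase : (w n : ℝ) + 1 ≤ β * s
    · have := key 1 le_rfl hcase
      refine ⟨1, le_rfl, by rw [hTy]; exact hTmem.2, this, n + 1, le_rfl, this, by simp⟩
    · push Not at hcase
      refine ⟨β * s - w n, by linarith, ?_, key _ (by linarith) (by linarith), k, by omega,
        hfull, ?_⟩
      · rw [hTy]; nlinarith
      · rw [hTy, show n + 1 - k = (n - k) + 1 by omega, pow_succ]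
        linear_combination β * hsk

/-- There are at least `βⁿ / (n + 1)` full words of length `n`. -/
theorem exists_finset_full {β : ℝ} (hβ : 1 < β) (n : ℕ) :
    ∃ F : Finset (ℕ → ℤ), (∀ w ∈ F, IsFull β n w ∧ ∀ i, n ≤ i → w i = 0) ∧
      β ^ n ≤ (n + 1) * F.card := by
  have hβ0 : 0 < β := by linarith
  set S : Set (ℕ → ℤ) := {w | IsFull β n w ∧ ∀ i, n ≤ i → w i = 0} with hS
  -- Finiteness need not be proved: an infinite set of full words would contain `⌈β ^ n⌉₊` of them.
  by_cases hfin : S.Finite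
  swap
  · obtain ⟨F, hF, hc⟩ := Set.Infinite.exists_subset_card_eq hfin ⌈β ^ n⌉₊
    refine ⟨F, fun w hw => hF hw, ?_⟩
    rw [hc]
    have := Nat.le_ceil (β ^ n)
    have h2 : (0 : ℝ) ≤ ⌈β ^ n⌉₊ := by positivity
    nlinarith [mul_nonneg (Nat.cast_nonneg (α := ℝ) n) h2]
  refine ⟨hfin.toFinset, fun w hw => hfin.mem_toFinset.1 hw, ?_⟩
  -- Each point lies within `β⁻¹ ^ n` of the right end of a full cylinder of order `k ≤ n`. Padding
  -- by zeros turns its word into an element of `S`, so `(n + 1) * #S` intervals of length `β⁻¹ ^ n`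
  -- cover `[0,1)`.
  have hcover : Ico (0 : ℝ) 1 ⊆ ⋃ k ∈ Finset.range (n + 1), ⋃ w ∈ hfin.toFinset,
      Ico (branch β k w 1 - β⁻¹ ^ n) (branch β k w 1) := by
    intro x hx
    obtain ⟨s, hs1, hxs, -, k, hk, hfull, hsk⟩ := exists_full_cylinder hβ hx n
    set d : ℕ → ℤ := fun i => digit β (i + 1) x with hd
    set w : ℕ → ℤ := fun i => if i < k then d i else 0 with hw
    have hdw : ∀ i < k, d i = w i := fun i hi => by simp [hw, hi]
    have hwS : w ∈ S := by
      refine ⟨?_, fun i hi => by simp [hw]; omega⟩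
      rw [← Nat.add_sub_of_le hk]
      refine (hfull.congr hdw).append hβ0 ?_
      simpa [hw] using isFull_zero hβ (n - k)
    simp only [mem_iUnion, Finset.mem_range, exists_prop]
    refine ⟨k, by omega, w, hfin.mem_toFinset.2 hwS, ?_⟩
    have h1 := branch_sub β k w 1 ((T β)^[k] x)
    rw [← branch_congr hdw ((T β)^[k] x), branch_digit hβ0] at h1
    have hTk := T_iterate_mem β hx k
    have hTn := T_iterate_mem β hx n
    have h2 : (1 - (T β)^[k] x) * β⁻¹ ^ k = (s - (T β)^[n] x) * β⁻¹ ^ n := by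
      rw [hsk]
      obtain ⟨r, rfl⟩ := Nat.exists_eq_add_of_le hk
      rw [Nat.add_sub_cancel_left, pow_add]
      have : β ^ r * β⁻¹ ^ r = 1 := by rw [← mul_pow, mul_inv_cancel₀ hβ0.ne', one_pow]
      linear_combination -(1 - (T β)^[k] x) * β⁻¹ ^ k * this
    have h3 : (0 : ℝ) < β⁻¹ ^ n := by positivity
    have h4 : 0 < (s - (T β)^[n] x) * β⁻¹ ^ n := mul_pos (by linarith) h3
    have h5 : (s - (T β)^[n] x) * β⁻¹ ^ n ≤ 1 * β⁻¹ ^ n :=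
      mul_le_mul_of_nonneg_right (by linarith [hTn.1]) h3.le
    constructor <;> linarith
  have hm := (MeasureTheory.measure_mono hcover).trans
    ((MeasureTheory.measure_biUnion_finset_le (μ := MeasureTheory.volume) _ _).trans
      (Finset.sum_le_sum fun k _ => MeasureTheory.measure_biUnion_finset_le _ _))
  simp only [Real.volume_Ico, sub_sub_cancel, sub_zero, ENNReal.ofReal_one, Finset.sum_const,
    Finset.card_range, nsmul_eq_mul] at hm
  have h3 : (0 : ℝ) < β⁻¹ ^ n := by positivity
  rw [← ENNReal.ofReal_natCast, ← ENNReal.ofReal_natCast, ← ENNReal.ofReal_mul (by positivity),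
    ← ENNReal.ofReal_mul (by positivity), ← ENNReal.ofReal_one,
    ENNReal.ofReal_le_ofReal_iff (by positivity)] at hm
  have h6 : β⁻¹ ^ n * β ^ n = 1 := by rw [← mul_pow, inv_mul_cancel₀ hβ0.ne', one_pow]
  have h7 : (0 : ℝ) < β ^ n := by positivity
  calc β ^ n = 1 * β ^ n := by ring
    _ ≤ (((n + 1 : ℕ) : ℝ) * (hfin.toFinset.card * β⁻¹ ^ n)) * β ^ n :=
        mul_le_mul_of_nonneg_right hm h7.le
    _ = (n + 1) * hfin.toFinset.card := by
        push_cast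
        linear_combination ((n : ℝ) + 1) * hfin.toFinset.card * h6

theorem IsFull.eq_of_branch_eq {β : ℝ} {n : ℕ} {w w' : ℕ → ℤ} (h : IsFull β n w)
    (h' : IsFull β n w') {s t : ℝ} (hs : s ∈ Ico (0 : ℝ) 1) (ht : t ∈ Ico (0 : ℝ) 1)
    (heq : branch β n w s = branch β n w' t) : ∀ i < n, w i = w' i := by
  intro i hi
  rw [← (h s hs).2 i hi, heq, (h' t ht).2 i hi]

/-- Cylinders of distinct full words of the same length are disjoint. -/
theorem IsFull.branch_one_le {β : ℝ} (hβ : 0 < β) {n : ℕ} {w w' : ℕ → ℤ} (h : IsFull β n w)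
    (h' : IsFull β n w') (hne : ¬ ∀ i < n, w i = w' i)
    (hle : branch β n w 0 ≤ branch β n w' 0) : branch β n w 1 ≤ branch β n w' 0 := by
  by_contra! hlt
  have hpos : (0 : ℝ) < β⁻¹ ^ n := by positivity
  have h0 := branch_sub β n w 1 0
  set s := (branch β n w' 0 - branch β n w 0) / β⁻¹ ^ n with hs
  have hsm : s * β⁻¹ ^ n = branch β n w' 0 - branch β n w 0 := div_mul_cancel₀ _ hpos.ne'
  have hs0 : s ∈ Ico (0 : ℝ) 1 :=
    ⟨div_nonneg (by linarith) hpos.le, by rw [hs, div_lt_one hpos]; linarith⟩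
  refine hne (h.eq_of_branch_eq h' hs0 (t := 0) (by simp) ?_)
  have := branch_sub β n w s 0
  linarith

/-! ### Block codes and their points -/

/-- A family of full words of a common length, consisting of the zero word (`none`) and of words
with a nonzero digit at a fixed place `mark`, whose cylinders stay away from `1`. -/
structure BlockCode (β : ℝ) (N : ℕ) where
  len : ℕ
  mark : ℕ
  mark_lt : mark < len
  word : Option (Fin N) → ℕ → ℤ
  full : ∀ o, IsFull β len (word o)
  gap : ℝ
  gap_pos : 0 < gap
  branch_one_le : ∀ o, branch β len (word o) 1 ≤ 1 - gap
  word_none : ∀ r, word none r = 0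
  word_mark : ∀ i, word (some i) mark ≠ 0
  inj : ∀ o o', (∀ r < len, word o r = word o' r) → o = o'

namespace BlockCode

variable {β : ℝ} {N : ℕ} (C : BlockCode β N)

/-- The contraction ratio of the block branches. -/
def ratio : ℝ := β⁻¹ ^ C.len

theorem len_pos : 0 < C.len := C.mark_lt.pos

theorem ratio_pos (hβ : 1 < β) : 0 < C.ratio := by
  have : 0 < β := by linarith
  unfold ratio; positivity

theorem ratio_lt_one (hβ : 1 < β) : C.ratio < 1 := by
  have : 0 < β := by linarith
  have hm := C.len_pos
  exact pow_lt_one₀ (by positivity) (inv_lt_one_of_one_lt₀ hβ) (by omega)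

/-- The point whose expansion is the concatenation of the blocks `ω 0, ω 1, …`. -/
def point (ω : ℕ → Option (Fin N)) : ℝ :=
  ∑' q, branch β C.len (C.word (ω q)) 0 * C.ratio ^ q

theorem branch_zero_nonneg (o : Option (Fin N)) : 0 ≤ branch β C.len (C.word o) 0 :=
  (C.full o 0 (by simp)).1.1

theorem branch_zero_le (o : Option (Fin N)) :
    branch β C.len (C.word o) 0 ≤ 1 - C.ratio := by
  have h := branch_sub β C.len (C.word o) 1 0
  have h1 := C.branch_one_le o
  have h2 := C.gap_pos
  unfold ratio
  linarith

theorem summable_point (hβ : 1 < β) (ω : ℕ → Option (Fin N)) :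
    Summable fun q => branch β C.len (C.word (ω q)) 0 * C.ratio ^ q := by
  have hr := (C.ratio_pos hβ).le
  exact Summable.of_nonneg_of_le
    (fun q => mul_nonneg (C.branch_zero_nonneg _) (pow_nonneg hr _))
    (fun q => mul_le_mul_of_nonneg_right (C.branch_zero_le _) (pow_nonneg hr _))
    ((summable_geometric_of_lt_one hr (C.ratio_lt_one hβ)).mul_left _)

theorem point_eq (hβ : 1 < β) (ω : ℕ → Option (Fin N)) :
    C.point ω = branch β C.len (C.word (ω 0)) (C.point fun q => ω (q + 1)) := by
  have h := (C.summable_point hβ ω).tsum_eq_zero_add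
  have h2 := branch_sub β C.len (C.word (ω 0)) (C.point fun q => ω (q + 1)) 0
  have h3 : ∑' q, branch β C.len (C.word (ω (q + 1))) 0 * C.ratio ^ (q + 1) =
      C.ratio * C.point fun q => ω (q + 1) := by
    rw [point, ← tsum_mul_left]
    exact tsum_congr fun q => by ring
  rw [h3] at h
  rw [point, h]
  unfold ratio at *
  simp only [pow_zero, mul_one] at *
  linarith

theorem point_nonneg (hβ : 1 < β) (ω : ℕ → Option (Fin N)) : 0 ≤ C.point ω :=
  tsum_nonneg fun _ => mul_nonneg (C.branch_zero_nonneg _) (pow_nonneg (C.ratio_pos hβ).le _)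

theorem point_le_one (hβ : 1 < β) (ω : ℕ → Option (Fin N)) : C.point ω ≤ 1 := by
  have hr := (C.ratio_pos hβ).le
  have hr1 := C.ratio_lt_one hβ
  have h := (C.summable_point hβ ω).tsum_le_tsum
    (fun q => mul_le_mul_of_nonneg_right (C.branch_zero_le _) (pow_nonneg hr _))
    ((summable_geometric_of_lt_one hr hr1).mul_left _)
  rwa [tsum_mul_left, tsum_geometric_of_lt_one hr hr1,
    mul_inv_cancel₀ (by linarith : 1 - C.ratio ≠ 0)] at h

/-- The cylinder of the first block ends at or before `1 - gap`. This puts points in `[0,1)`, where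
full branches apply, and separates points with different first blocks. -/
theorem point_le (hβ : 1 < β) (ω : ℕ → Option (Fin N)) : C.point ω ≤ 1 - C.gap := by
  rw [C.point_eq hβ]
  refine le_trans ?_ (C.branch_one_le (ω 0))
  have h := branch_sub β C.len (C.word (ω 0)) 1 (C.point fun q => ω (q + 1))
  have h2 := mul_nonneg (sub_nonneg.2 (C.point_le_one hβ fun q => ω (q + 1))) (C.ratio_pos hβ).le
  unfold ratio at h2
  linarith

theorem point_mem (hβ : 1 < β) (ω : ℕ → Option (Fin N)) : C.point ω ∈ Ico (0 : ℝ) 1 :=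
  ⟨C.point_nonneg hβ ω, by linarith [C.point_le hβ ω, C.gap_pos]⟩

theorem iterate_point (hβ : 1 < β) (ω : ℕ → Option (Fin N)) (q : ℕ) :
    (T β)^[C.len * q] (C.point ω) = C.point fun i => ω (q + i) := by
  induction q with
  | zero => simp
  | succ q ih =>
    rw [Nat.mul_succ, add_comm, Function.iterate_add_apply, ih, C.point_eq hβ,
      (C.full _).iterate_branch (by linarith) (C.point_mem hβ _)]
    congr 1
    funext i
    congr 1
    omega

theorem digit_point (hβ : 1 < β) (ω : ℕ → Option (Fin N)) (q : ℕ) {r : ℕ} (hr : r < C.len) :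
    digit β (C.len * q + r + 1) (C.point ω) = C.word (ω q) r := by
  rw [← digit_iterate, C.iterate_point hβ, C.point_eq hβ,
    (C.full _ _ (C.point_mem hβ _)).2 r hr]
  simp

/-- Points that are close have a long common prefix of blocks. -/
theorem eq_of_abs_sub_lt (hβ : 1 < β) (n : ℕ) (ω ω' : ℕ → Option (Fin N))
    (h : |C.point ω - C.point ω'| < C.gap * C.ratio ^ n) : ∀ q < n, ω q = ω' q := by
  have hβ0 : 0 < β := by linarith
  have hr := C.ratio_pos hβ
  have hr1 := C.ratio_lt_one hβ
  -- Distinct first blocks have disjoint cylinders, and the left point stays `gap * ratio` away from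
  -- the right end of its own.
  have aux : ∀ ω ω' : ℕ → Option (Fin N), ω 0 ≠ ω' 0 →
      branch β C.len (C.word (ω 0)) 0 ≤ branch β C.len (C.word (ω' 0)) 0 →
      C.gap * C.ratio ≤ C.point ω' - C.point ω := by
    intro ω ω' hne hle
    have h1 := (C.full (ω 0)).branch_one_le hβ0 (C.full (ω' 0))
      (fun hh => hne (C.inj _ _ hh)) hle
    rw [C.point_eq hβ ω, C.point_eq hβ ω']
    have h2 := branch_sub β C.len (C.word (ω 0)) 1 (C.point fun q => ω (q + 1))
    have h3 := branch_sub β C.len (C.word (ω' 0)) (C.point fun q => ω' (q + 1)) 0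
    have h4 := C.point_le hβ fun q => ω (q + 1)
    have h5 := C.point_nonneg hβ fun q => ω' (q + 1)
    have h6 : C.gap * C.ratio ≤ (1 - C.point fun q => ω (q + 1)) * C.ratio :=
      mul_le_mul_of_nonneg_right (by linarith) hr.le
    have h7 := mul_nonneg h5 hr.le
    unfold ratio at *
    linarith
  induction n generalizing ω ω' with
  | zero => intro q hq; omega
  | succ n ih =>
    have h0 : ω 0 = ω' 0 := by
      by_contra hne
      have hle : C.gap * C.ratio ≤ |C.point ω - C.point ω'| := by
        rcases le_total (branch β C.len (C.word (ω 0)) 0) (branch β C.len (C.word (ω' 0)) 0)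
          with h1 | h1
        · rw [abs_sub_comm]; exact (aux ω ω' hne h1).trans (le_abs_self _)
        · exact (aux ω' ω (Ne.symm hne) h1).trans (le_abs_self _)
      have : C.gap * C.ratio ^ (n + 1) ≤ C.gap * C.ratio :=
        mul_le_mul_of_nonneg_left (pow_le_of_le_one hr.le hr1.le (by omega)) C.gap_pos.le
      linarith
    intro q hq
    rcases q with _ | q
    · exact h0
    · refine ih (fun q => ω (q + 1)) (fun q => ω' (q + 1)) ?_ q (by omega)
      rw [C.point_eq hβ ω, C.point_eq hβ ω', h0, branch_sub, abs_mul] at h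
      change _ * |C.ratio| < _ at h
      rw [abs_of_pos hr, pow_succ, ← mul_assoc] at h
      exact lt_of_mul_lt_mul_right h hr.le

end BlockCode

/-! ### Block codes of almost maximal growth -/

/-- The surplus `β ^ ((1 - r) * L)` beats both the factor `L + 1` lost in counting full words and
the cost of a suffix of length `j`. The second inequality gives more than one word. -/
theorem eventually_pow_mul_le {β : ℝ} (hβ : 1 < β) {r : ℝ} (hr : r < 1) (j : ℕ) :
    ∃ L : ℕ, β ^ (((L + j : ℕ) : ℝ) * r) * (L + 1) ≤ β ^ L ∧ L + 1 < β ^ L := by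
  have hβ0 : 0 < β := by linarith
  have key : ∀ ρ : ℝ, 1 < ρ → Tendsto (fun n : ℕ => ((n : ℝ) + 1) * ρ⁻¹ ^ n) atTop (nhds 0) := by
    intro ρ hρ
    have hi : ρ⁻¹ < 1 := inv_lt_one_of_one_lt₀ hρ
    have hi0 : 0 ≤ ρ⁻¹ := inv_nonneg.2 (by linarith)
    have := (tendsto_self_mul_const_pow_of_lt_one hi0 hi).add
      (tendsto_pow_atTop_nhds_zero_of_lt_one hi0 hi)
    simpa [add_mul] using this
  set ρ := β ^ (1 - r) with hρ
  have hρ1 : 1 < ρ := Real.one_lt_rpow hβ (by linarith)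
  have hc : 0 < (β ^ ((j : ℝ) * r))⁻¹ := by positivity
  obtain ⟨L, h1, h2⟩ := (((key ρ hρ1).eventually (gt_mem_nhds hc)).and
    ((key β hβ).eventually (gt_mem_nhds one_pos))).exists
  refine ⟨L, ?_, ?_⟩
  · have e1 : β ^ (((L + j : ℕ) : ℝ) * r) = β ^ ((j : ℝ) * r) * β ^ ((L : ℝ) * r) := by
      rw [← Real.rpow_add hβ0]; congr 1; push_cast; ring
    have e2 : β ^ L = ρ ^ L * β ^ ((L : ℝ) * r) := by
      rw [hρ, ← Real.rpow_natCast, ← Real.rpow_natCast, ← Real.rpow_mul hβ0.le,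
        ← Real.rpow_add hβ0]
      congr 1; ring
    have hρL : (0 : ℝ) < ρ ^ L := by positivity
    rw [inv_pow, ← div_eq_mul_inv, div_lt_iff₀ hρL, inv_mul_eq_div,
      lt_div_iff₀ (by positivity)] at h1
    rw [e1, e2]
    have := mul_le_mul_of_nonneg_right h1.le (by positivity : (0 : ℝ) ≤ β ^ ((L : ℝ) * r))
    linarith
  · have : (0 : ℝ) < β ^ L := by positivity
    rw [inv_pow, ← div_eq_mul_inv, div_lt_one this] at h2
    exact h2

/-- Block codes with almost maximal growth exist. -/
theorem exists_blockCode {β : ℝ} (hβ : 1 < β) {r : ℝ} (hr : r < 1) :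
    ∃ (N : ℕ) (C : BlockCode β N), 2 ≤ N ∧ β ^ ((C.len : ℝ) * r) ≤ N := by
  have hβ0 : 0 < β := by linarith
  have hi : β⁻¹ < 1 := inv_lt_one_of_one_lt₀ hβ
  obtain ⟨j, hj⟩ := exists_pow_lt_of_lt_one (by linarith : 0 < β - 1) hi
  obtain ⟨L, hL1, hL2⟩ := eventually_pow_mul_le hβ hr (j + 1)
  obtain ⟨F, hF, hcard⟩ := exists_finset_full hβ L
  have hLpos : (0 : ℝ) < L + 1 := by positivity
  let φ : Fin F.card → ℕ → ℤ := fun i => (F.equivFin.symm i : ℕ → ℤ)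
  have hφ : ∀ i, IsFull β L (φ i) := fun i => (hF _ (F.equivFin.symm i).2).1
  let e : ℕ → ℤ := fun i => if i = 0 then 1 else 0
  have he : IsFull β (j + 1) e := isFull_one_zeros hβ (by linarith)
  -- The suffix `1 0 … 0` gives each nonzero block its nonzero digit at place `L`. Its cylinder ends
  -- at `(1 + β⁻¹ ^ j) / β < 1`, which keeps the block's cylinder away from `1`.
  let blk : Fin F.card → ℕ → ℤ := fun i k => if k < L then φ i k else e (k - L)
  have hblk1 : ∀ i, ∀ k < L, φ i k = blk i k := fun i k hk => by simp [blk, hk]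
  have hblk2 : ∀ i, (fun k => blk i (L + k)) = e := fun i => by funext k; simp [blk]
  let word : Option (Fin F.card) → ℕ → ℤ := fun o => o.elim (fun _ => 0) blk
  have hfull : ∀ o, IsFull β (L + (j + 1)) (word o) := by
    rintro (_ | i)
    · exact isFull_zero hβ _
    · refine ((hφ i).congr (hblk1 i)).append hβ0 ?_
      change IsFull β (j + 1) (fun k => blk i (L + k))
      rw [hblk2]; exact he
  have hlt : ∀ o, branch β (L + (j + 1)) (word o) 1 < 1 := by
    rintro (_ | i)
    · change branch β (L + (j + 1)) (fun _ => 0) 1 < 1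
      rw [branch_zero_word, one_mul]
      exact pow_lt_one₀ (by positivity) hi (by omega)
    · change branch β (L + (j + 1)) (blk i) 1 < 1
      rw [branch_append, hblk2, ← branch_congr (hblk1 i)]
      refine ((hφ i) _ ?_).1.2
      have : branch β (j + 1) e 1 = (1 + β⁻¹ ^ j) / β := by
        rw [add_comm j 1, branch_append]
        have : (fun i => e (1 + i)) = fun _ => 0 := by funext i; simp [e]
        rw [this, branch_zero_word, branch_succ hβ0]
        simp [e]
      rw [this]
      exact ⟨by positivity, by rw [div_lt_one hβ0]; linarith⟩
  obtain ⟨o₀, ho₀⟩ := Finite.exists_max fun o => branch β (L + (j + 1)) (word o) 1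
  let C : BlockCode β F.card :=
    { len := L + (j + 1)
      mark := L
      mark_lt := by omega
      word := word
      full := hfull
      gap := 1 - branch β (L + (j + 1)) (word o₀) 1
      gap_pos := by linarith [hlt o₀]
      branch_one_le := fun o => by linarith [ho₀ o]
      word_none := fun _ => rfl
      word_mark := fun i => by simp [word, blk, e]
      inj := by
        rintro (_ | i) (_ | i') h
        · rfl
        · exact absurd (h L (by omega)) (by simp [word, blk, e])
        · exact absurd (h L (by omega)) (by simp [word, blk, e])
        · congr 1
          apply F.equivFin.symm.injective
          apply Subtype.ext
          funext k
          rcases lt_or_ge k L with hk | hk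
          · have := h k (by omega)
            simpa [word, blk, hk] using this
          · rw [(hF _ (F.equivFin.symm i).2).2 k hk, (hF _ (F.equivFin.symm i').2).2 k hk] }
  refine ⟨F.card, C, ?_, ?_⟩
  · have : ((1 : ℕ) : ℝ) < F.card := by
      push_cast
      by_contra! hle
      nlinarith
    exact_mod_cast this
  · have h := hL1.trans hcard
    rw [mul_comm] at h
    exact le_of_mul_le_mul_left h hLpos

/-! ### Source and target block sequences -/

/-- The places reserved for copies of prefixes of the target: the `k`-th copy has `k + 3` blocks,
starts at `p k` and is followed by one zero block. -/
def Reserved (p : ℕ → ℕ) (q : ℕ) : Prop := ∃ k, p k ≤ q ∧ q ≤ p k + k + 3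

/-- Two zero blocks followed by the blocks of `v`. -/
def targetSeq {N : ℕ} (v : ℕ → Fin N) (q : ℕ) : Option (Fin N) :=
  if q < 2 then none else some (v (q - 2))

open Classical in
/-- The blocks of `u` at the free places, prefixes of `targetSeq v` at the reserved ones. -/
def sourceSeq {N : ℕ} (p : ℕ → ℕ) (u v : ℕ → Fin N) (q : ℕ) : Option (Fin N) :=
  if h : Reserved p q then
    if q = p h.choose + h.choose + 3 then none else targetSeq v (q - p h.choose)
  else some (u (Nat.count (fun i => ¬ Reserved p i) q))

section Sequences

variable {N : ℕ} {p : ℕ → ℕ} {u v : ℕ → Fin N}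

/-- The `5` leaves a free place after each closing zero block, so it is never adjacent to the
opening zeros of the next copy. -/
theorem gap_of_lt (hp : ∀ k, p k + k + 5 ≤ p (k + 1)) {k l : ℕ} (h : k < l) :
    p k + k + 5 ≤ p l :=
  (hp k).trans (monotone_nat_of_le_succ (fun k => by have := hp k; omega) h)

theorem reserved_unique (hp : ∀ k, p k + k + 5 ≤ p (k + 1)) {k l q : ℕ}
    (hk : p k ≤ q ∧ q ≤ p k + k + 3) (hl : p l ≤ q ∧ q ≤ p l + l + 3) : k = l := by
  rcases lt_trichotomy k l with h | h | h
  · have := gap_of_lt hp h; omega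
  · exact h
  · have := gap_of_lt hp h; omega

theorem sourceSeq_reserved (hp : ∀ k, p k + k + 5 ≤ p (k + 1)) {k q : ℕ}
    (hk : p k ≤ q ∧ q ≤ p k + k + 3) :
    sourceSeq p u v q = if q = p k + k + 3 then none else targetSeq v (q - p k) := by
  have h : Reserved p q := ⟨k, hk⟩
  rw [sourceSeq, dif_pos h, reserved_unique hp h.choose_spec hk]

theorem sourceSeq_copy (hp : ∀ k, p k + k + 5 ≤ p (k + 1)) {k i : ℕ} (hi : i < k + 3) :
    sourceSeq p u v (p k + i) = targetSeq v i := by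
  rw [sourceSeq_reserved hp (k := k) (by omega), if_neg (by omega)]
  simp

theorem sourceSeq_end (hp : ∀ k, p k + k + 5 ≤ p (k + 1)) (k : ℕ) :
    sourceSeq p u v (p k + k + 3) = none := by
  rw [sourceSeq_reserved hp (k := k) (by omega), if_pos rfl]

theorem sourceSeq_free {q : ℕ} (h : ¬ Reserved p q) : ∃ i, sourceSeq p u v q = some i := by
  rw [sourceSeq, dif_neg h]; exact ⟨_, rfl⟩

theorem targetSeq_eq_none {q : ℕ} : targetSeq v q = none ↔ q < 2 := by
  unfold targetSeq; split_ifs with h <;> simp [h]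

theorem eq_of_sourceSeq_none (hp : ∀ k, p k + k + 5 ≤ p (k + 1)) {q : ℕ}
    (h : sourceSeq p u v q = none) : ∃ k, q = p k ∨ q = p k + 1 ∨ q = p k + k + 3 := by
  by_cases hr : Reserved p q
  · obtain ⟨k, hk⟩ := hr
    refine ⟨k, ?_⟩
    rw [sourceSeq_reserved hp hk] at h
    split_ifs at h with h1
    · exact Or.inr (Or.inr h1)
    · rw [targetSeq_eq_none] at h; omega
  · obtain ⟨i, hi⟩ := sourceSeq_free (u := u) (v := v) hr
    rw [h] at hi; cases hi

/-- Two consecutive zero blocks occur only at the start of a copy. -/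
theorem eq_of_sourceSeq_none_none (hp : ∀ k, p k + k + 5 ≤ p (k + 1)) {q : ℕ}
    (h : sourceSeq p u v q = none) (h' : sourceSeq p u v (q + 1) = none) : ∃ k, q = p k := by
  obtain ⟨k, hk | hk | hk⟩ := eq_of_sourceSeq_none hp h
  · exact ⟨k, hk⟩
  · rw [hk, add_assoc, sourceSeq_copy hp (by omega), targetSeq_eq_none] at h'
    omega
  · exfalso
    obtain ⟨l, hl⟩ := eq_of_sourceSeq_none hp h'
    rcases lt_trichotomy k l with h1 | h1 | h1
    · have := gap_of_lt hp h1; omega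
    · subst h1; omega
    · have := gap_of_lt hp h1; omega

end Sequences

/-! ### Waiting times of coded pairs -/

theorem mem_basicInterval_iff {β : ℝ} {n : ℕ} {x y : ℝ} :
    x ∈ basicInterval β n y ↔
      x ∈ Ico (0 : ℝ) 1 ∧ ∀ i < n, digit β (i + 1) x = digit β (i + 1) y := by
  refine and_congr_right fun _ => ⟨fun h i hi => h _ (by simp; omega), fun h i hi => ?_⟩
  rw [Finset.mem_Icc] at hi
  obtain ⟨r, rfl⟩ := Nat.exists_eq_add_of_le' hi.1
  exact h r (by omega)

theorem waitingTime_mono (β x y : ℝ) : Monotone fun n => waitingTime β n x y := by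
  intro n n' h
  refine sInf_le_sInf (image_mono fun k hk => ⟨hk.1, ?_⟩)
  have := hk.2
  rw [mem_basicInterval_iff] at this ⊢
  exact ⟨this.1, fun i hi => this.2 i (by omega)⟩

namespace BlockCode

variable {β : ℝ} {N : ℕ} (C : BlockCode β N) {p : ℕ → ℕ} (u v : ℕ → Fin N)

theorem digit_point' (hβ : 1 < β) (ω : ℕ → Option (Fin N)) {q r i : ℕ} (hr : r < C.len)
    (hi : i = C.len * q + r) : digit β (i + 1) (C.point ω) = C.word (ω q) r := by
  rw [hi, C.digit_point hβ _ _ hr]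

theorem eq_none_of_word_mark {o : Option (Fin N)} (h : C.word o C.mark = 0) : o = none := by
  rcases o with _ | i
  · rfl
  · exact absurd h (C.word_mark i)

/-- Prefixes of the target occur in the source only at the starts of copies. -/
theorem occurrence (hβ : 1 < β) (hp : ∀ k, p k + k + 5 ≤ p (k + 1)) {n s : ℕ} (hn : 3 ≤ n)
    (h : ∀ i < C.len * n, digit β (s + i + 1) (C.point (sourceSeq p u v)) =
      digit β (i + 1) (C.point (targetSeq v))) : ∃ k, n ≤ k + 3 ∧ s = C.len * p k := by
  have hm := C.mark_lt
  set m := C.len with hmdef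
  set L := C.mark with hL
  set x := C.point (sourceSeq p u v)
  set y := C.point (targetSeq v)
  have hmn : m * 3 ≤ m * n := Nat.mul_le_mul_left _ hn
  have hy0 : ∀ i < 2 * m, digit β (i + 1) y = 0 := by
    intro i hi
    have h1 : i / m < 2 := (Nat.div_lt_iff_lt_mul (by omega)).2 hi
    rw [C.digit_point' hβ _ (q := i / m) (Nat.mod_lt _ (by omega)) (Nat.div_add_mod i m).symm,
      targetSeq_eq_none.2 h1, C.word_none]
  have hx0 : ∀ i, s ≤ i → i < s + 2 * m → digit β (i + 1) x = 0 := by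
    intro i hi hi'
    obtain ⟨r, rfl⟩ := Nat.exists_eq_add_of_le hi
    rw [h r (by omega), hy0 r (by omega)]
  have hnone : ∀ q, s ≤ m * q + L → m * q + L < s + 2 * m → sourceSeq p u v q = none := by
    intro q h1 h2
    refine C.eq_none_of_word_mark ?_
    rw [← C.digit_point hβ _ q hm]
    exact hx0 _ h1 h2
  -- the copy containing the two zero blocks
  obtain ⟨k, hk1, hk2⟩ : ∃ k, s < m * p k + m ∧ m * p k < s + m := by
    have hs := Nat.div_add_mod s m
    have hs' := Nat.mod_lt s (show 0 < m by omega)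
    have e1 : m * (s / m + 1) = m * (s / m) + m := by ring
    have e2 : m * (s / m + 1 + 1) = m * (s / m) + 2 * m := by ring
    -- The window of `2 * m` zero digits contains two consecutive mark places, and the offset of `s`
    -- decides in which block the first one lies.
    rcases le_or_gt (s % m) L with hr | hr
    · obtain ⟨k, hk⟩ := eq_of_sourceSeq_none_none hp (hnone (s / m) (by omega) (by omega))
        (hnone (s / m + 1) (by omega) (by omega))
      exact ⟨k, by rw [← hk]; omega, by rw [← hk]; omega⟩
    · obtain ⟨k, hk⟩ := eq_of_sourceSeq_none_none hp (hnone (s / m + 1) (by omega) (by omega))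
        (hnone (s / m + 1 + 1) (by omega) (by omega))
      exact ⟨k, by rw [← hk]; omega, by rw [← hk]; omega⟩
  have hcopy : ∀ i < m * 3, digit β (m * p k + i + 1) x = digit β (i + 1) y := by
    intro i hi
    have h1 : i / m < 3 := (Nat.div_lt_iff_lt_mul (by omega)).2 (by omega)
    have h2 := Nat.mod_lt i (show 0 < m by omega)
    have h3 := Nat.div_add_mod i m
    rw [C.digit_point' hβ _ (q := i / m) h2 h3.symm,
      C.digit_point' hβ _ (q := p k + i / m) h2 (by rw [mul_add, add_assoc, h3]),
      sourceSeq_copy hp (by omega)]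
  -- the first nonzero digit of the target
  have hex : ∃ z, digit β (z + 1) y ≠ 0 := by
    refine ⟨m * 2 + L, ?_⟩
    rw [C.digit_point hβ _ 2 hm]
    simpa [targetSeq] using C.word_mark _
  classical
  have hz := Nat.find_spec hex
  have hzmin : ∀ i < Nat.find hex, digit β (i + 1) y = 0 := fun i hi => by
    simpa using Nat.find_min hex hi
  have hz1 : 2 * m ≤ Nat.find hex := by
    by_contra! hlt
    exact hz (hy0 _ hlt)
  have hz2 : Nat.find hex ≤ m * 2 + L := by
    refine Nat.find_min' hex ?_
    rw [C.digit_point hβ _ 2 hm]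
    simpa [targetSeq] using C.word_mark _
  generalize Nat.find hex = z at hz hzmin hz1 hz2
  -- A nonzero shift, being shorter than one block, would place the first nonzero digit of the
  -- target on one of its leading zeros.
  have hsk : s = m * p k := by
    rcases lt_trichotomy s (m * p k) with hlt | heq | hgt
    · exfalso
      apply hz
      rw [← h z (by omega), show s + z + 1 = m * p k + (z - (m * p k - s)) + 1 by omega,
        hcopy _ (by omega)]
      exact hzmin _ (by omega)
    · exact heq
    · exfalso
      apply hz
      rw [← hcopy z (by omega), show m * p k + z + 1 = s + (z - (s - m * p k)) + 1 by omega,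
        h _ (by omega)]
      exact hzmin _ (by omega)
  refine ⟨k, ?_, hsk⟩
  -- A longer match would compare the closing zero block with a nonzero block of the target.
  by_contra! hlt
  have hle : m * (k + 3 + 1) ≤ m * n := Nat.mul_le_mul_left _ hlt
  have e1 : m * (k + 3 + 1) = m * (k + 3) + m := by ring
  have h1 := h (m * (k + 3) + L) (by omega)
  rw [C.digit_point hβ _ (k + 3) hm,
    C.digit_point' hβ _ (q := p k + k + 3) hm (by rw [hsk]; ring), sourceSeq_end hp,
    C.word_none] at h1
  have h2 := targetSeq_eq_none.1 (C.eq_none_of_word_mark h1.symm)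
  omega

/-- The `k`-th copy gives the upper bound. By `occurrence` any match starts at a copy `l ≥ k`, which
gives the lower one. -/
theorem waitingTime_eq (hβ : 1 < β) (hp : ∀ k, p k + k + 5 ≤ p (k + 1)) (hp0 : ∀ k, 1 ≤ p k)
    (k : ℕ) : waitingTime β (C.len * (k + 3)) (C.point (sourceSeq p u v))
      (C.point (targetSeq v)) = ((C.len * p k : ℕ) : ℕ∞) := by
  have hm := C.len_pos
  apply le_antisymm
  · refine sInf_le ⟨C.len * p k, ⟨Nat.mul_pos hm (hp0 k), ?_⟩, rfl⟩
    rw [mem_basicInterval_iff]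
    refine ⟨T_iterate_mem _ (C.point_mem hβ _) _, fun i hi => ?_⟩
    rw [digit_iterate]
    have h1 : i / C.len < k + 3 := (Nat.div_lt_iff_lt_mul hm).2 (by rwa [mul_comm])
    have h2 := Nat.mod_lt i hm
    have h3 := Nat.div_add_mod i C.len
    rw [C.digit_point' hβ _ (q := i / C.len) h2 h3.symm,
      C.digit_point' hβ _ (q := p k + i / C.len) h2 (by rw [mul_add, add_assoc, h3]),
      sourceSeq_copy hp (by omega)]
  · refine le_sInf ?_
    rintro _ ⟨s, ⟨-, hs⟩, rfl⟩
    rw [mem_basicInterval_iff] at hs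
    obtain ⟨l, hl, rfl⟩ := C.occurrence u v hβ hp (n := k + 3) (s := s) (by omega) fun i hi => by
      rw [← digit_iterate]; exact hs.2 i hi
    have hmono : Monotone p := monotone_nat_of_le_succ fun k => by have := hp k; omega
    exact Nat.cast_le.2 (Nat.mul_le_mul_left _ (hmono (by omega : k ≤ l)))

/-- Bounds for all waiting times. -/
theorem exists_waitingTime (hβ : 1 < β) (hp : ∀ k, p k + k + 5 ≤ p (k + 1))
    (hp0 : ∀ k, 1 ≤ p k) {n k : ℕ} (h1 : C.len * (k + 3) ≤ n) (h2 : n ≤ C.len * (k + 4)) :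
    ∃ w : ℕ, waitingTime β n (C.point (sourceSeq p u v)) (C.point (targetSeq v)) = w ∧
      p k ≤ w ∧ w ≤ C.len * p (k + 1) := by
  have l1 := waitingTime_mono β (C.point (sourceSeq p u v)) (C.point (targetSeq v)) h1
  have l2 := waitingTime_mono β (C.point (sourceSeq p u v)) (C.point (targetSeq v)) h2
  simp only at l1 l2
  rw [C.waitingTime_eq u v hβ hp hp0] at l1
  rw [show k + 4 = k + 1 + 3 by ring, C.waitingTime_eq u v hβ hp hp0] at l2
  obtain ⟨w, hw⟩ := ENat.ne_top_iff_exists.1 (ne_top_of_le_ne_top (ENat.natCast_ne_top _) l2)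
  rw [← hw] at l1 l2
  refine ⟨w, hw.symm, ?_, by exact_mod_cast l2⟩
  have : C.len * p k ≤ w := by exact_mod_cast l1
  exact le_trans (Nat.le_mul_of_pos_left _ C.len_pos) this

end BlockCode

/-! ### Hölder comparison and density of free places -/

/-- If `k` factors through `h` with Hölder exponent `r`, tested along a geometric scale, then the
dimension of the range of `k` is controlled by that of the range of `h`. -/
theorem dimH_range_le_of_geometric_scale {ι X Y : Type*} [MetricSpace X] [MetricSpace Y]
    (h : ι → X) (k : ι → Y) {c Q K : ℝ} {r : NNReal} (hc : 0 < c) (hQ : 0 < Q) (hQ1 : Q < 1)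
    (hr : 0 < r) (hK : ∀ a b, dist (k a) (k b) ≤ K)
    (H : ∀ a b (n : ℕ), dist (h a) (h b) ≤ c * Q ^ n →
      dist (k a) (k b) ≤ K * (Q ^ (r : ℝ)) ^ n) :
    dimH (range k) ≤ dimH (range h) / r := by
  rcases isEmpty_or_nonempty ι with hι | hι
  · simp [range_eq_empty k]
  have hK0 : 0 ≤ K := dist_nonneg.trans (hK hι.some hι.some)
  have hr' : (0 : ℝ) < r := hr
  have hQr : Q ^ (r : ℝ) < 1 := Real.rpow_lt_one hQ.le hQ1 hr'
  have hQr0 : 0 < Q ^ (r : ℝ) := Real.rpow_pos_of_pos hQ _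
  have key : ∀ a b, dist (k a) (k b) ≤ K * (c * Q)⁻¹ ^ (r : ℝ) * dist (h a) (h b) ^ (r : ℝ) := by
    intro a b
    set ρ := dist (h a) (h b) with hρ
    have hρ0 : 0 ≤ ρ := dist_nonneg
    rw [mul_assoc, ← Real.mul_rpow (by positivity) hρ0]
    rcases hρ0.eq_or_lt with h0 | hpos
    · have hlim : Tendsto (fun n : ℕ => K * (Q ^ (r : ℝ)) ^ n) atTop (nhds 0) := by
        simpa using (tendsto_pow_atTop_nhds_zero_of_lt_one hQr0.le hQr).const_mul K
      refine (ge_of_tendsto' hlim fun n => H a b n ?_).trans (by positivity)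
      rw [← hρ, ← h0]; positivity
    rcases le_or_gt (ρ / c) 1 with h1 | h1
    · obtain ⟨n, hn1, hn2⟩ := exists_nat_pow_near_of_lt_one (div_pos hpos hc) h1 hQ hQ1
      rw [div_le_iff₀ hc, mul_comm] at hn2
      refine (H a b n hn2).trans (mul_le_mul_of_nonneg_left ?_ hK0)
      rw [← Real.rpow_natCast, ← Real.rpow_mul hQ.le, mul_comm, Real.rpow_mul hQ.le,
        Real.rpow_natCast]
      refine Real.rpow_le_rpow (by positivity) ?_ hr'.le
      rw [inv_mul_eq_div, le_div_iff₀ (by positivity)]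
      rw [lt_div_iff₀ hc, pow_succ] at hn1
      linarith
    · refine (hK a b).trans (le_mul_of_one_le_right hK0 (Real.one_le_rpow ?_ hr'.le))
      rw [one_lt_div hc] at h1
      rw [inv_mul_eq_div, one_le_div (by positivity)]
      nlinarith
  set A : NNReal := ⟨K * (c * Q)⁻¹ ^ (r : ℝ), by positivity⟩ with hA
  -- The bound `key` makes `k` constant on the fibres of `h`, so any section of `h` exhibits the
  -- factor map.
  have hinv : ∀ a, h (Function.invFun h (h a)) = h a := fun a =>
    Function.invFun_eq ⟨a, rfl⟩
  have hfac : ∀ a, k (Function.invFun h (h a)) = k a := by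
    intro a
    have := key (Function.invFun h (h a)) a
    rw [hinv, dist_self, Real.zero_rpow hr'.ne', mul_zero] at this
    exact dist_le_zero.1 this
  have hHol : HolderOnWith A r (k ∘ Function.invFun h) (range h) := by
    rintro _ ⟨a, rfl⟩ _ ⟨b, rfl⟩
    simp only [Function.comp, hfac]
    rw [edist_dist, edist_dist, ENNReal.ofReal_rpow_of_nonneg dist_nonneg hr'.le,
      ← ENNReal.ofReal_coe_nnreal, ← ENNReal.ofReal_mul A.coe_nonneg]
    exact ENNReal.ofReal_le_ofReal (key a b)
  have himg : (k ∘ Function.invFun h) '' range h = range k := by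
    rw [← range_comp]
    congr 1
    funext a
    exact hfac a
  rw [← himg]
  exact hHol.dimH_image_le hr

open Classical in
/-- If the copies start late, few places are reserved. -/
theorem mul_card_reserved_le {p : ℕ → ℕ} (hp : ∀ k, p k + k + 5 ≤ p (k + 1)) {D : ℕ}
    (hD : ∀ k, D * (k + 2) ^ 2 ≤ p k) (n : ℕ) :
    D * ((Finset.range n).filter (Reserved p)).card ≤ 2 * n := by
  have hmono : StrictMono p := strictMono_nat_of_lt_succ fun k => by have := hp k; omega
  have hex : ∃ k, n ≤ p k := ⟨n, hmono.le_apply⟩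
  have hmin : ∀ k < Nat.find hex, p k < n := fun k hk => by
    simpa using Nat.find_min hex hk
  have hspec := Nat.find_spec hex
  generalize Nat.find hex = K at hmin hspec
  have hsub : (Finset.range n).filter (Reserved p) ⊆
      (Finset.range K).biUnion fun k => Finset.Icc (p k) (p k + k + 3) := by
    intro q hq
    rw [Finset.mem_filter, Finset.mem_range] at hq
    obtain ⟨hqn, k, hk1, hk2⟩ := hq
    rw [Finset.mem_biUnion]
    refine ⟨k, ?_, Finset.mem_Icc.2 ⟨hk1, hk2⟩⟩
    rw [Finset.mem_range]
    by_contra! hKk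
    have := hmono.monotone hKk
    omega
  have hsum : ∀ K : ℕ, ∑ k ∈ Finset.range K, (Finset.Icc (p k) (p k + k + 3)).card ≤
      2 * (K + 1) ^ 2 := by
    intro K
    induction K with
    | zero => simp
    | succ K ih =>
      rw [Finset.sum_range_succ, Nat.card_Icc]
      have : p K + K + 3 + 1 - p K = K + 4 := by omega
      rw [this]
      nlinarith
  rcases K with _ | K
  · have := Finset.card_le_card hsub
    simp only [Finset.range_zero, Finset.biUnion_empty, Finset.card_empty, Nat.le_zero] at this
    rw [this]; omega
  -- Here `K` is the last index with `p K < n`, so `D * (K + 2) ^ 2 ≤ p K < n`.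
  · have h1 := (Finset.card_le_card hsub).trans (Finset.card_biUnion_le.trans (hsum (K + 1)))
    have h2 := hmin K (by omega)
    have h3 := hD K
    have h4 := Nat.mul_le_mul_left D h1
    nlinarith

-- Reserved places have density at most `2 / D ≤ 1 - r`.
open Classical in
theorem le_count_free {p : ℕ → ℕ} (hp : ∀ k, p k + k + 5 ≤ p (k + 1)) {D : ℕ}
    (hD : ∀ k, D * (k + 2) ^ 2 ≤ p k) {r : ℝ} (hr : 2 ≤ D * (1 - r)) (hr1 : r < 1) (n : ℕ) :
    n * r ≤ Nat.count (fun i => ¬ Reserved p i) n := by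
  have h1 := mul_card_reserved_le hp hD n
  have h2 := Finset.card_filter_add_card_filter_not (s := Finset.range n) (Reserved p)
  rw [Finset.card_range] at h2
  rw [Nat.count_eq_card_filter_range]
  have h3 : (D : ℝ) * ((Finset.range n).filter (Reserved p)).card ≤ 2 * n := by exact_mod_cast h1
  have h4 : (((Finset.range n).filter (Reserved p)).card : ℝ) +
      ((Finset.range n).filter fun i => ¬ Reserved p i).card = n := by exact_mod_cast h2
  have hDpos : (0 : ℝ) < D := by
    by_contra! hle
    nlinarith
  have h5 : (D : ℝ) * ((Finset.range n).filter (Reserved p)).card ≤ D * ((1 - r) * n) := by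
    nlinarith [mul_le_mul_of_nonneg_right hr (Nat.cast_nonneg (α := ℝ) n)]
  have h6 := le_of_mul_le_mul_left h5 hDpos
  linarith

-- Free places list `u` in order, so a common prefix of the sources determines as many terms of `u`
-- as it has free places.
open Classical in
theorem eq_of_sourceSeq_eq {N : ℕ} {p : ℕ → ℕ} {u u' v v' : ℕ → Fin N} {n : ℕ}
    (h : ∀ q < n, sourceSeq p u v q = sourceSeq p u' v' q) :
    ∀ i < Nat.count (fun i => ¬ Reserved p i) n, u i = u' i := by
  induction n with
  | zero => simp
  | succ n ih =>
    intro i hi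
    rw [Nat.count_succ] at hi
    by_cases hf : ¬ Reserved p n
    · rw [if_pos hf] at hi
      rcases Nat.lt_succ_iff_lt_or_eq.1 hi with hi | rfl
      · exact ih (fun q hq => h q (by omega)) i hi
      · have := h n (by omega)
        rw [sourceSeq, sourceSeq, dif_neg hf, dif_neg hf] at this
        exact Option.some.inj this
    · rw [if_neg hf] at hi
      exact ih (fun q hq => h q (by omega)) i hi

theorem eq_of_targetSeq_eq {N : ℕ} {v v' : ℕ → Fin N} {n : ℕ}
    (h : ∀ q < n, targetSeq v q = targetSeq v' q) : ∀ i < n - 2, v i = v' i := by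
  intro i hi
  have := h (i + 2) (by omega)
  simpa [targetSeq] using this

/-! ### Choice of copy positions -/

theorem le_log_ceil_exp (g : ℝ) (hg : 0 ≤ g) :
    Real.exp g ≤ (⌈Real.exp g⌉₊ : ℝ) ∧ (⌈Real.exp g⌉₊ : ℝ) ≤ 2 * Real.exp g := by
  have h1 := Real.one_le_exp hg
  have h2 := Nat.ceil_lt_add_one (Real.exp_pos g).le
  exact ⟨Nat.le_ceil _, by linarith⟩

/-- Copy positions of prescribed growth. -/
theorem exists_positions (g : ℕ → ℝ) (hg : Monotone g) (hg0 : 0 ≤ g 0) {D : ℕ} (hD : 1 ≤ D) :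
    ∃ p : ℕ → ℕ, (∀ k, p k + k + 5 ≤ p (k + 1)) ∧ (∀ k, D * (k + 2) ^ 2 ≤ p k) ∧
      ∀ k, g k ≤ Real.log (p k) ∧
        Real.log (p k) ≤ Real.log (2 * D) + 2 * Real.log (k + 2) + g k := by
  have hgk : ∀ k, 0 ≤ g k := fun k => hg0.trans (hg (Nat.zero_le k))
  have hc1 : ∀ k, 1 ≤ ⌈Real.exp (g k)⌉₊ := fun k => Nat.one_le_ceil_iff.2 (Real.exp_pos _)
  have hDr : (1 : ℝ) ≤ D := by exact_mod_cast hD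
  -- The factor `D * (k + 2) ^ 2` enforces spacing and sparsity at logarithmic cost; the ceiling
  -- supplies the growth `g`.
  refine ⟨fun k => D * (k + 2) ^ 2 * ⌈Real.exp (g k)⌉₊, fun k => ?_, fun k => ?_, fun k => ?_⟩
  · have h1 : ⌈Real.exp (g k)⌉₊ ≤ ⌈Real.exp (g (k + 1))⌉₊ :=
      Nat.ceil_mono (Real.exp_le_exp.2 (hg (Nat.le_succ k)))
    calc D * (k + 2) ^ 2 * ⌈Real.exp (g k)⌉₊ + k + 5
        ≤ D * (k + 2) ^ 2 * ⌈Real.exp (g k)⌉₊ + 1 * (2 * k + 5) * 1 := by omega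
      _ ≤ D * (k + 2) ^ 2 * ⌈Real.exp (g k)⌉₊ + D * (2 * k + 5) * ⌈Real.exp (g k)⌉₊ := by
          gcongr; exact hc1 k
      _ = D * (k + 1 + 2) ^ 2 * ⌈Real.exp (g k)⌉₊ := by ring
      _ ≤ _ := Nat.mul_le_mul_left _ h1
  · exact Nat.le_mul_of_pos_right _ (hc1 k)
  · obtain ⟨h1, h2⟩ := le_log_ceil_exp (g k) (hgk k)
    have hk : (1 : ℝ) ≤ (k + 2 : ℝ) ^ 2 := by
      have : (0 : ℝ) ≤ k := by positivity
      nlinarith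
    have hDk : 1 ≤ (D : ℝ) * (k + 2 : ℝ) ^ 2 := by nlinarith
    have he := Real.exp_pos (g k)
    push_cast
    constructor
    · rw [Real.le_log_iff_exp_le (by positivity)]
      nlinarith
    · calc Real.log (D * (k + 2) ^ 2 * ⌈Real.exp (g k)⌉₊)
          ≤ Real.log (2 * D * (k + 2) ^ 2 * Real.exp (g k)) := by
            apply Real.log_le_log (by positivity)
            nlinarith
        _ = _ := by
            rw [Real.log_mul (by positivity) he.ne', Real.log_mul (by positivity) (by positivity),
              Real.log_pow, Real.log_exp]
            push_cast; ring

/-- Positions for which every sequence of waiting times compatible with them has rate `a`. -/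
theorem exists_positions_rate (a : ℝ≥0∞) {m D : ℕ} (hm : 1 ≤ m) (hD : 1 ≤ D) :
    ∃ p : ℕ → ℕ, (∀ k, p k + k + 5 ≤ p (k + 1)) ∧ (∀ k, D * (k + 2) ^ 2 ≤ p k) ∧
      ∀ w : ℕ → ℕ, (∀ n k, m * (k + 3) ≤ n → n ≤ m * (k + 4) →
        p k ≤ w n ∧ w n ≤ m * p (k + 1)) →
      Tendsto (fun n : ℕ => ((Real.log (w n) / n : ℝ) : EReal)) atTop (nhds (a : EReal)) := by
  have hmr : (1 : ℝ) ≤ m := by exact_mod_cast hm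
  have hDr : (1 : ℝ) ≤ D := by exact_mod_cast hD
  have hfind : ∀ n : ℕ, 3 * m ≤ n → ∃ k, m * (k + 3) ≤ n ∧ n ≤ m * (k + 4) := by
    intro n hn
    have h1 : 3 ≤ n / m := (Nat.le_div_iff_mul_le hm).2 hn
    refine ⟨n / m - 3, ?_, ?_⟩
    · rw [Nat.sub_add_cancel h1]; exact Nat.mul_div_le n m
    · rw [show n / m - 3 + 4 = n / m + 1 by omega]
      exact (Nat.lt_mul_div_succ n hm).le
  induction a with
  | top =>
    obtain ⟨p, hp1, hp2, hp3⟩ := exists_positions (fun k => (k : ℝ) ^ 2)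
      (fun k l h => by
        have : (k : ℝ) ≤ l := by exact_mod_cast h
        simp only; gcongr) (by simp) hD
    refine ⟨p, hp1, hp2, fun w hw => ?_⟩
    rw [EReal.coe_ennreal_top, EReal.tendsto_coe_nhds_top_iff]
    have hlim : Tendsto (fun n : ℕ => (n : ℝ) / (4 * m ^ 2)) atTop atTop :=
      tendsto_natCast_atTop_atTop.atTop_div_const (by positivity)
    -- From `8 * m ≤ n ≤ m * (k + 4)` follows `n ≤ 2 * m * k`, so `k ^ 2` is at least `n ^ 2 / (4 *
    -- m ^ 2)`.
    refine tendsto_atTop_mono' _ ?_ hlim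
    filter_upwards [eventually_ge_atTop (8 * m)] with n hn
    obtain ⟨k, hk1, hk2⟩ := hfind n (by omega)
    have hnr : (8 * m : ℝ) ≤ n := by exact_mod_cast hn
    have hk2r : (n : ℝ) ≤ m * (k + 4) := by exact_mod_cast hk2
    have hn0 : (0 : ℝ) < n := by linarith
    have hpk : (0 : ℝ) < p k := by
      have : 0 < p k := lt_of_lt_of_le (by positivity) (hp2 k)
      exact_mod_cast this
    have h1 : (k : ℝ) ^ 2 ≤ Real.log (w n) :=
      (hp3 k).1.trans (Real.log_le_log hpk (by exact_mod_cast (hw n k hk1 hk2).1))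
    rw [div_le_div_iff₀ (by positivity) hn0]
    have h2 : (n : ℝ) ≤ 2 * m * k := by linarith
    have h3 : (n : ℝ) * n ≤ (2 * m * k) * (2 * m * k) := by gcongr
    nlinarith [mul_le_mul_of_nonneg_right h1 (by positivity : (0 : ℝ) ≤ 4 * m ^ 2)]
  | coe α =>
    have hα : (0 : ℝ) ≤ α := α.2
    obtain ⟨p, hp1, hp2, hp3⟩ := exists_positions (fun k => (α : ℝ) * m * k)
      (fun k l h => by
        have : (k : ℝ) ≤ l := by exact_mod_cast h
        simp only; gcongr) (by simp) hD
    refine ⟨p, hp1, hp2, fun w hw => ?_⟩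
    change Tendsto _ _ (nhds ((α : ℝ) : EReal))
    refine EReal.tendsto_coe.2 ?_
    have hlow : Tendsto (fun n : ℕ => (α : ℝ) - 4 * m * α / n) atTop (nhds α) := by
      simpa using tendsto_const_nhds.sub (tendsto_const_div_atTop_nhds_zero_nat (4 * m * (α : ℝ)))
    have hupp : Tendsto (fun n : ℕ => (α : ℝ) + (Real.log m + Real.log (2 * D)) / n +
        2 * (Real.log n / n)) atTop (nhds α) := by
      have hl : Tendsto (fun n : ℕ => Real.log n / n) atTop (nhds 0) :=
        (Real.isLittleO_log_id_atTop.tendsto_div_nhds_zero).comp tendsto_natCast_atTop_atTop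
      simpa using (tendsto_const_nhds.add (tendsto_const_div_atTop_nhds_zero_nat
        (Real.log m + Real.log (2 * D)))).add (hl.const_mul 2)
    refine tendsto_of_tendsto_of_tendsto_of_le_of_le' hlow hupp ?_ ?_
    all_goals
      filter_upwards [eventually_ge_atTop (3 * m)] with n hn
      obtain ⟨k, hk1, hk2⟩ := hfind n (by omega)
      have hnr : (3 * m : ℝ) ≤ n := by exact_mod_cast hn
      have hk2r : (n : ℝ) ≤ m * (k + 4) := by exact_mod_cast hk2
      have hk1r : (m : ℝ) * (k + 3) ≤ n := by exact_mod_cast hk1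
      have hn0 : (0 : ℝ) < n := by linarith
      have hpos : ∀ k, (0 : ℝ) < p k := fun k => by
        have : 0 < p k := lt_of_lt_of_le (by positivity) (hp2 k)
        exact_mod_cast this
      obtain ⟨hw1, hw2⟩ := hw n k hk1 hk2
    · have h1 : (α : ℝ) * m * k ≤ Real.log (w n) :=
        (hp3 k).1.trans (Real.log_le_log (hpos k) (by exact_mod_cast hw1))
      rw [le_div_iff₀ hn0, sub_mul, div_mul_cancel₀ _ hn0.ne']
      nlinarith [mul_le_mul_of_nonneg_left hk2r hα]
    · have hw0 : (0 : ℝ) < w n := lt_of_lt_of_le (hpos k) (by exact_mod_cast hw1)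
      have h1 : Real.log (w n) ≤ Real.log m + Real.log (p (k + 1)) := by
        rw [← Real.log_mul (by positivity) (hpos _).ne']
        exact Real.log_le_log hw0 (by exact_mod_cast hw2)
      have h2 := (hp3 (k + 1)).2
      push_cast at h2
      have h3 : Real.log ((k : ℝ) + 1 + 2) ≤ Real.log n :=
        Real.log_le_log (by positivity) (by nlinarith)
      have h4 : (α : ℝ) * m * (k + 1) ≤ α * n := by
        rw [mul_assoc]
        exact mul_le_mul_of_nonneg_left (by nlinarith) hα
      rw [div_le_iff₀ hn0]
      have h5 : ((α : ℝ) + (Real.log m + Real.log (2 * D)) / n + 2 * (Real.log n / n)) * n =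
          α * n + (Real.log m + Real.log (2 * D)) + 2 * Real.log n := by
        field_simp
      rw [h5]
      linarith

/-! ### Dimension of the level set -/

theorem waitingRate_eq {β x y : ℝ} {n w : ℕ} (h : waitingTime β n x y = w) (hw : 0 < w) :
    waitingRate β x y n = ((Real.log w / n : ℝ) : EReal) := by
  rw [waitingRate, h, ENat.toENNReal_coe, ← ENNReal.ofReal_natCast,
    ENNReal.log_ofReal_of_pos (by exact_mod_cast hw), EReal.coe_div]
  rfl

theorem abs_sub_le_dist (x y x' y' : ℝ) :
    |x - x'| ≤ dist (!₂[x, y] : EuclideanSpace ℝ (Fin 2)) !₂[x', y'] ∧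
    |y - y'| ≤ dist (!₂[x, y] : EuclideanSpace ℝ (Fin 2)) !₂[x', y'] ∧
    dist (!₂[x, y] : EuclideanSpace ℝ (Fin 2)) !₂[x', y'] ≤ |x - x'| + |y - y'| := by
  rw [EuclideanSpace.dist_eq]
  simp only [Fin.sum_univ_two, Real.dist_eq, sq_abs, Matrix.cons_val_zero, Matrix.cons_val_one]
  refine ⟨Real.abs_le_sqrt (by nlinarith [sq_nonneg (y - y')]),
    Real.abs_le_sqrt (by nlinarith [sq_nonneg (x - x')]), ?_⟩
  rw [Real.sqrt_le_left (by positivity)]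
  nlinarith [sq_abs (x - x'), sq_abs (y - y'),
    mul_nonneg (abs_nonneg (x - x')) (abs_nonneg (y - y'))]

/-- Base `N` expansions reach every point of the open unit square, so the range has interior. -/
theorem dimH_range_ofDigits {N : ℕ} (hN : 2 ≤ N) :
    dimH (range fun a : (ℕ → Fin N) × (ℕ → Fin N) =>
      (!₂[Real.ofDigits a.1, Real.ofDigits a.2] : EuclideanSpace ℝ (Fin 2))) = 2 := by
  have : NeZero N := ⟨by omega⟩
  rw [Real.dimH_of_nonempty_interior, finrank_euclideanSpace]
  · simp
  · set U : Set (EuclideanSpace ℝ (Fin 2)) := {z | z 0 ∈ Ioo (0 : ℝ) 1 ∧ z 1 ∈ Ioo (0 : ℝ) 1}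
    have hU : IsOpen U :=
      (isOpen_Ioo.preimage (by fun_prop : Continuous fun z : EuclideanSpace ℝ (Fin 2) => z 0)).inter
        (isOpen_Ioo.preimage (by fun_prop : Continuous fun z : EuclideanSpace ℝ (Fin 2) => z 1))
    refine ⟨!₂[1 / 2, 1 / 2], mem_interior.2 ⟨U, ?_, hU, ?_⟩⟩
    · rintro z ⟨h0, h1⟩
      refine ⟨(Real.digits (z 0) N, Real.digits (z 1) N), ?_⟩
      simp only
      rw [Real.ofDigits_digits (by omega) ⟨h0.1.le, h0.2⟩,
        Real.ofDigits_digits (by omega) ⟨h1.1.le, h1.2⟩]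
      ext i
      fin_cases i <;> rfl
    · simp only [U, mem_ofPred_eq]
      norm_num

namespace BlockCode

variable {β : ℝ} {N : ℕ} (C : BlockCode β N)

/-- The pair (source point, target point) of two digit sequences. -/
def pair (p : ℕ → ℕ) (a : (ℕ → Fin N) × (ℕ → Fin N)) : EuclideanSpace ℝ (Fin 2) :=
  !₂[C.point (sourceSeq p a.1 a.2), C.point (targetSeq a.2)]

theorem pair_mem_levelSet (hβ : 1 < β) {p : ℕ → ℕ} (hp : ∀ k, p k + k + 5 ≤ p (k + 1))
    (hp0 : ∀ k, 1 ≤ p k) {a : ℝ≥0∞}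
    (ha : ∀ w : ℕ → ℕ, (∀ n k, C.len * (k + 3) ≤ n → n ≤ C.len * (k + 4) →
        p k ≤ w n ∧ w n ≤ C.len * p (k + 1)) →
      Tendsto (fun n : ℕ => ((Real.log (w n) / n : ℝ) : EReal)) atTop (nhds (a : EReal)))
    (b : (ℕ → Fin N) × (ℕ → Fin N)) : C.pair p b ∈ levelSet β a := by
  set x := C.point (sourceSeq p b.1 b.2) with hx
  set y := C.point (targetSeq b.2) with hy
  suffices h : Tendsto (waitingRate β x y) atTop (nhds (a : EReal)) from
    ⟨C.point_mem hβ _, C.point_mem hβ _, h.liminf_eq, h.limsup_eq⟩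
  have hW := fun {n k : ℕ} => C.exists_waitingTime (n := n) (k := k) b.1 b.2 hβ hp hp0
  -- The value of `toNat` at infinity is harmless: only `n ≥ 3 * C.len` matters, where the waiting
  -- time is finite.
  refine (ha (fun n => (waitingTime β n x y).toNat) fun n k h1 h2 => ?_).congr' ?_
  · obtain ⟨w, hw, hw'⟩ := hW h1 h2
    rw [hw]; exact hw'
  · filter_upwards [eventually_ge_atTop (C.len * 3)] with n hn
    have h1 : 3 ≤ n / C.len := (Nat.le_div_iff_mul_le C.len_pos).2 (by rwa [mul_comm])
    obtain ⟨w, hw, hw1, -⟩ := hW (n := n) (k := n / C.len - 3)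
      (by rw [Nat.sub_add_cancel h1]; exact Nat.mul_div_le n C.len)
      (by rw [show n / C.len - 3 + 4 = n / C.len + 1 by omega]
          exact (Nat.lt_mul_div_succ n C.len_pos).le)
    rw [waitingRate_eq hw ((hp0 _).trans hw1), hw]
    rfl

/-- One factor `r` is lost because `N` is only at least `β ^ (len * r)`, the other because only a
proportion `r` of the source blocks is known to be free. -/
theorem two_le_dimH_range_pair_div (hβ : 1 < β) (hN : 2 ≤ N) {p : ℕ → ℕ}
    (hp : ∀ k, p k + k + 5 ≤ p (k + 1)) {D : ℕ} (hD : ∀ k, D * (k + 2) ^ 2 ≤ p k)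
    {r : NNReal} (hr0 : 0 < r) (hr1 : r < 1) (hr : 2 ≤ D * (1 - (r : ℝ)))
    (hC : β ^ ((C.len : ℝ) * r) ≤ N) :
    2 ≤ dimH (range (C.pair p)) / ((r * r : NNReal) : ℝ≥0∞) := by
  classical
  have hβ0 : 0 < β := by linarith
  have hQ := C.ratio_pos hβ
  have hN1 : (1 : ℝ) ≤ N := by exact_mod_cast (by omega : 1 ≤ N)
  have hr1' : (r : ℝ) < 1 := hr1
  have hr0' : (0 : ℝ) < r := hr0
  refine (dimH_range_ofDigits hN).symm.le.trans ?_
  have hscale : ∀ n : ℕ, ((N : ℝ) ^ ((n : ℝ) * r))⁻¹ ≤ (C.ratio ^ ((r * r : NNReal) : ℝ)) ^ n := by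
    intro n
    have e : (C.ratio ^ ((r * r : NNReal) : ℝ)) ^ n =
        ((β ^ ((C.len : ℝ) * r)) ^ ((n : ℝ) * r))⁻¹ := by
      rw [ratio, inv_pow, Real.inv_rpow (by positivity), inv_pow, ← Real.rpow_natCast β,
        ← Real.rpow_mul hβ0.le, ← Real.rpow_mul hβ0.le, ← Real.rpow_natCast, ← Real.rpow_mul hβ0.le]
      congr 2
      push_cast; ring
    rw [e]
    gcongr
  -- Halving `gap` gives the strict inequality of `eq_of_abs_sub_lt`. In `K`, `N ^ 2` pays for the
  -- two zero blocks opening the target and `2` for the two coordinates.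
  refine dimH_range_le_of_geometric_scale (C.pair p) _ (c := C.gap / 2) (Q := C.ratio)
    (K := 2 * (N : ℝ) ^ 2) (half_pos C.gap_pos) hQ (C.ratio_lt_one hβ) (mul_pos hr0 hr0) ?_ ?_
  · intro a b
    refine (abs_sub_le_dist _ _ _ _).2.2.trans ?_
    have h1 := Real.abs_ofDigits_sub_ofDigits_le (x := a.1) (y := b.1) (n := 0) (by simp)
    have h2 := Real.abs_ofDigits_sub_ofDigits_le (x := a.2) (y := b.2) (n := 0) (by simp)
    simp only [pow_zero, inv_one] at h1 h2
    nlinarith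
  · intro a b n hn
    have hlt : C.gap / 2 * C.ratio ^ n < C.gap * C.ratio ^ n :=
      mul_lt_mul_of_pos_right (half_lt_self C.gap_pos) (by positivity)
    have hd := abs_sub_le_dist (C.point (sourceSeq p a.1 a.2)) (C.point (targetSeq a.2))
      (C.point (sourceSeq p b.1 b.2)) (C.point (targetSeq b.2))
    have hx := C.eq_of_abs_sub_lt hβ n _ _ ((hd.1.trans hn).trans_lt hlt)
    have hy := C.eq_of_abs_sub_lt hβ n _ _ ((hd.2.1.trans hn).trans_lt hlt)
    have h1 := Real.abs_ofDigits_sub_ofDigits_le (eq_of_sourceSeq_eq hx)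
    have h2 := Real.abs_ofDigits_sub_ofDigits_le (eq_of_targetSeq_eq hy)
    refine (abs_sub_le_dist _ _ _ _).2.2.trans ?_
    set S := (C.ratio ^ ((r * r : NNReal) : ℝ)) ^ n with hS
    have hS0 : 0 ≤ S := by positivity
    have hNN : (1 : ℝ) ≤ (N : ℝ) ^ 2 := one_le_pow₀ hN1
    have h3 : ((N : ℝ) ^ Nat.count (fun i => ¬ Reserved p i) n)⁻¹ ≤ S := by
      refine le_trans ?_ (hscale n)
      rw [← Real.rpow_natCast]
      gcongr
      exact le_count_free hp hD hr hr1' n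
    have h4 : ((N : ℝ) ^ (n - 2))⁻¹ ≤ (N : ℝ) ^ 2 * S := by
      have h5 : ((N : ℝ) ^ n)⁻¹ ≤ S := by
        refine le_trans ?_ (hscale n)
        rw [← Real.rpow_natCast]
        gcongr
        exact mul_le_of_le_one_right (by positivity) hr1'.le
      have h6 : (N : ℝ) ^ n ≤ (N : ℝ) ^ 2 * (N : ℝ) ^ (n - 2) := by
        rw [← pow_add]; exact pow_le_pow_right₀ hN1 (by omega)
      have h7 : ((N : ℝ) ^ (n - 2))⁻¹ ≤ (N : ℝ) ^ 2 * ((N : ℝ) ^ n)⁻¹ := by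
        rw [← div_eq_mul_inv, inv_eq_one_div, div_le_div_iff₀ (by positivity) (by positivity)]
        linarith
      exact h7.trans (mul_le_mul_of_nonneg_left h5 (by positivity))
    nlinarith

end BlockCode

theorem le_dimH_levelSet {β : ℝ} (hβ : 1 < β) (a : ℝ≥0∞) {r : NNReal} (hr0 : 0 < r)
    (hr1 : r < 1) : 2 * ((r * r : NNReal) : ℝ≥0∞) ≤ dimH (levelSet β a) := by
  have hr1' : (r : ℝ) < 1 := hr1
  obtain ⟨N, C, hN, hC⟩ := exists_blockCode hβ hr1'
  obtain ⟨D, hD⟩ := exists_nat_ge (2 / (1 - (r : ℝ)))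
  have hr : 2 ≤ D * (1 - (r : ℝ)) := (div_le_iff₀ (by linarith)).1 hD
  have hD1 : 1 ≤ D := by
    rcases D.eq_zero_or_pos with rfl | h
    · norm_num at hr
    · exact h
  obtain ⟨p, hp1, hp2, hp3⟩ := exists_positions_rate a C.len_pos hD1
  have hp0 : ∀ k, 1 ≤ p k := fun k => (Nat.mul_pos hD1 (by positivity)).trans_le (hp2 k)
  have h := C.two_le_dimH_range_pair_div hβ hN hp1 hp2 hr0 hr1 hr hC
  have hrr : ((r * r : NNReal) : ℝ≥0∞) ≠ 0 := ENNReal.coe_ne_zero.2 (mul_pos hr0 hr0).ne'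
  rw [ENNReal.le_div_iff_mul_le (Or.inl hrr) (Or.inl ENNReal.coe_ne_top)] at h
  refine h.trans (dimH_mono ?_)
  rintro _ ⟨b, rfl⟩
  exact C.pair_mem_levelSet hβ hp1 hp0 hp3 b

end

end BetaWaiting

theorem mainTheorem2 (β : ℝ) (hβ : 1 < β) (a : ℝ≥0∞) :
    dimH (BetaWaiting.levelSet β a) = 2 := by
  apply le_antisymm
  · refine (dimH_mono (subset_univ _)).trans ?_
    rw [Real.dimH_univ_eq_finrank, finrank_euclideanSpace]
    simp
  · have hlim : Tendsto (fun r : NNReal => 2 * ((r * r : NNReal) : ℝ≥0∞)) (nhdsWithin 1 (Iio 1))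
        (nhds 2) := by
      have h1 : Tendsto (fun r : NNReal => 2 * ((r * r : NNReal) : ℝ≥0∞)) (nhds 1)
          (nhds (2 * ((1 * 1 : NNReal) : ℝ≥0∞))) :=
        ENNReal.Tendsto.const_mul (ENNReal.tendsto_coe.2
          (continuous_id.mul continuous_id).continuousAt) (Or.inr (by simp))
      simpa using h1.mono_left nhdsWithin_le_nhds
    have : (nhdsWithin (1 : NNReal) (Iio 1)).NeBot := nhdsLT_neBot_of_exists_lt ⟨0, one_pos⟩
    refine le_of_tendsto hlim ?_
    filter_upwards [Ioo_mem_nhdsLT (one_pos : (0 : NNReal) < 1)] with r hr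
    exact BetaWaiting.le_dimH_levelSet hβ a hr.1 hr.2
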